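/- Let $J(12,6)$ be the Johnson graph, whose vertices are the binary words of length $12$ with exactly six ones, two words being adjacent if and only if they differ in exactly two positions. A Steiner system $S(5,6,12)$ is a set of vertices of $J(12,6)$ such that every maximum clique of $J(12,6)$ (clique of largest size) contains exactly one word of the set. Two pairs $(C_0,C_1)$ and $(S_0,S_1)$ of sets of vertices of a graph are equivalent if there is an automorphism $\pi$ of the graph such that either $\pi(S_0)=C_0$ and $\pi(S_1)=C_1$, or $\pi(S_0)=C_1$ and $\pi(S_1)=C_0$. Up to equivalence, there is exactly one pair of disjoint Steiner systems $S(5,6,12)$: such a pair exists, and any two such pairs are equivalent. -/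

import Mathlib

/-- The vertices of the Johnson graph `J(n, k)`: the binary words of length `n` and weight `k`,
each written as its support, a `k`-subset of the `n` coordinates. -/
abbrev JohnsonVertex (n k : ℕ) : Type := {s : Finset (Fin n) // s.card = k}

/-- The Johnson graph `J(n, k)`: two words are adjacent if and only if they differ in exactly
two positions. -/
def johnsonGraph (n k : ℕ) : SimpleGraph (JohnsonVertex n k) where
  Adj s t := (symmDiff s.1 t.1).card = 2
  symm := ⟨fun s t h => by rw [symmDiff_comm]; exact h⟩
  loopless := ⟨fun s h => by simp at h⟩

/-- A Steiner `k`-tuple system `S(k - 1, k, n)`, where `n ≥ 2 k`: a set of vertices of `J(n, k)`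
such that every maximum clique (clique of largest size) contains exactly one element of it. -/
def IsSteinerSystem {n k : ℕ} (W : Set (JohnsonVertex n k)) : Prop :=
  2 * k ≤ n ∧ ∀ B : Finset (JohnsonVertex n k), (johnsonGraph n k).IsMaximumClique B →
    ∃! s, s ∈ B ∧ s ∈ W

/-- Two pairs `(C₀, C₁)` and `(S₀, S₁)` of sets of vertices of a graph are equivalent if some
automorphism `π` of the graph maps `S₀, S₁` to `C₀, C₁` or to `C₁, C₀`, respectively. -/
def PairEquivalent {V : Type*} (G : SimpleGraph V) (C S : Set V × Set V) : Prop :=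
  ∃ π : G ≃g G, (π '' S.1 = C.1 ∧ π '' S.2 = C.2) ∨ (π '' S.1 = C.2 ∧ π '' S.2 = C.1)

/-- A pair of disjoint Steiner systems `S(5, 6, 12)`. -/
def IsDisjointWittPair (W : Set (JohnsonVertex 12 6) × Set (JohnsonVertex 12 6)) : Prop :=
  IsSteinerSystem W.1 ∧ IsSteinerSystem W.2 ∧ Disjoint W.1 W.2

/-! The maximum cliques of `J(12, 6)` are of two kinds, each with seven vertices: the 6-sets
containing a given 5-set and the 6-sets inside a given 7-set (`isMaximumClique_johnsonGraph_iff`).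
The first kind alone says that every 5-set lies in exactly one member (`IsHexadSystem`), and
uniqueness uses nothing more. The 7-sets matter only for existence, where they are checked for
`wittMask`.

Uniqueness rests on two exhaustive searches with isomorph rejection. By `wittTree`, a coordinate
permutation carries any system to `wittMask`. By `disjointTree`, any system disjoint from `wittMask`
is carried to one fixed disjoint image of it by a permutation that preserves `wittMask`. Composing
the two brings every disjoint pair to the same normal form.

For evaluation in the kernel, a family of subsets is a 4096-bit number, so that inserting or erasing
a point in all members at once is a bit shift. `SearchTree.isSolvedMask_of_check` turns a checked
certificate into a statement about all systems. -/

open Pointwise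

/-! ### Families of sets as binary masks -/

/-- The points `0, …, 11`, as a list. -/
def wittPoints : List (Fin 12) := [0, 1, 2, 3, 4, 5, 6, 7, 8, 9, 10, 11]

theorem mem_wittPoints (i : Fin 12) : i ∈ wittPoints := by
  revert i; decide

/-- The binary code of a set of points. -/
def setCode (s : Finset (Fin 12)) : ℕ := ∑ i ∈ s, 2 ^ (i : ℕ)

/-- The family of the sets whose codes are the positions of the ones of `C`. -/
def maskFamily (C : ℕ) : Set (Finset (Fin 12)) := {s | C.testBit (setCode s) = true}

/-- The mask of the family of all sets. -/
def fullMask : ℕ := 2 ^ 4096 - 1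

/-- The mask of the family of the sets that avoid `i`. -/
def avoidMask (i : Fin 12) : ℕ := fullMask / (2 ^ 2 ^ (i : ℕ) + 1)

/-- The mask of the complementary family. -/
def complMask (C : ℕ) : ℕ := fullMask ^^^ C

/-- The mask of the sets avoiding `i` that enter the family when `i` is inserted. -/
def downMask (i : Fin 12) (C : ℕ) : ℕ := (C >>> 2 ^ (i : ℕ)) &&& avoidMask i

/-- The mask of the sets containing `i` that enter the family when `i` is erased. -/
def upMask (i : Fin 12) (C : ℕ) : ℕ := (C <<< 2 ^ (i : ℕ)) &&& complMask (avoidMask i)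

theorem setCode_insert {i : Fin 12} {s : Finset (Fin 12)} (h : i ∉ s) :
    setCode (insert i s) = setCode s + 2 ^ (i : ℕ) := by
  rw [setCode, Finset.sum_insert h, add_comm, setCode]

theorem setCode_erase {i : Fin 12} {s : Finset (Fin 12)} (h : i ∈ s) :
    setCode (s.erase i) + 2 ^ (i : ℕ) = setCode s :=
  Finset.sum_erase_add s _ h

theorem testBit_setCode (s : Finset (Fin 12)) (i : Fin 12) :
    (setCode s).testBit i = decide (i ∈ s) := by
  have h : setCode s = ∑ k ∈ s.map Fin.valEmbedding, 2 ^ k := by simp [setCode]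
  have h2 := Finset.toFinset_bitIndices_sum_two_pow (s.map Fin.valEmbedding)
  rw [← h] at h2
  have h3 := Finset.ext_iff.1 h2 i
  simp [Fin.val_inj] at h3
  by_cases hi : i ∈ s <;> simp_all

theorem setCode_injective : Function.Injective setCode := by
  intro s t h
  ext i
  have := testBit_setCode s i
  rw [h, testBit_setCode] at this
  simpa using this.symm

theorem setCode_lt (s : Finset (Fin 12)) : setCode s < 4096 := by
  refine (Finset.sum_le_sum_of_subset (Finset.subset_univ s)).trans_lt ?_
  decide

theorem exists_setCode {m : ℕ} (hm : m < 4096) : ∃ s, setCode s = m := by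
  have hinj : Function.Injective fun s : Finset (Fin 12) => (⟨setCode s, setCode_lt s⟩ : Fin 4096) :=
    fun s t h => setCode_injective (by simpa using h)
  obtain ⟨s, hs⟩ := ((Fintype.bijective_iff_injective_and_card _).2 ⟨hinj, by simp⟩).2 ⟨m, hm⟩
  exact ⟨s, by simpa using hs⟩

/-- The division defining `avoidMask i` is exact, so the mask and its shift by `2 ^ i` places add up
to `fullMask` and are complementary. This recursion determines all bits of the mask. -/
theorem avoidMask_eq (i : Fin 12) :
    avoidMask i = fullMask ^^^ ((avoidMask i <<< 2 ^ (i : ℕ)) &&& fullMask) := by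
  revert i
  decide +kernel

theorem testBit_fullMask_iff {m : ℕ} : fullMask.testBit m = true ↔ m < 4096 := by
  rw [fullMask, Nat.testBit_two_pow_sub_one, decide_eq_true_iff]

theorem testBit_avoidMask (i : Fin 12) {m : ℕ} (hm : m < 4096) :
    (avoidMask i).testBit m = !m.testBit i := by
  induction m using Nat.strong_induction_on with
  | _ m ih =>
    rw [avoidMask_eq, Nat.testBit_xor, Nat.testBit_and, testBit_fullMask_iff.2 hm, Nat.testBit_shiftLeft]
    have hpos : 0 < 2 ^ (i : ℕ) := by positivity
    by_cases h : 2 ^ (i : ℕ) ≤ m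
    · obtain ⟨k, rfl⟩ := Nat.exists_eq_add_of_le h
      rw [Nat.add_sub_cancel_left, ih k (by omega) (by omega), Nat.testBit_two_pow_add_eq]
      simp
    · rw [Nat.testBit_lt_two_pow (not_le.1 h)]
      simp [h]

theorem mem_maskFamily {C : ℕ} {s : Finset (Fin 12)} :
    s ∈ maskFamily C ↔ C.testBit (setCode s) = true := Iff.rfl

@[simp] theorem maskFamily_zero : maskFamily 0 = ∅ := by
  ext s; simp [mem_maskFamily]

@[simp] theorem mem_maskFamily_and {C D : ℕ} {s : Finset (Fin 12)} :
    s ∈ maskFamily (C &&& D) ↔ s ∈ maskFamily C ∧ s ∈ maskFamily D := by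
  simp [mem_maskFamily]

@[simp] theorem mem_maskFamily_or {C D : ℕ} {s : Finset (Fin 12)} :
    s ∈ maskFamily (C ||| D) ↔ s ∈ maskFamily C ∨ s ∈ maskFamily D := by
  simp [mem_maskFamily]

@[simp] theorem mem_maskFamily_compl {C : ℕ} {s : Finset (Fin 12)} :
    s ∈ maskFamily (complMask C) ↔ s ∉ maskFamily C := by
  simp [mem_maskFamily, complMask, testBit_fullMask_iff.2 (setCode_lt s)]

@[simp] theorem mem_maskFamily_avoid {i : Fin 12} {s : Finset (Fin 12)} :
    s ∈ maskFamily (avoidMask i) ↔ i ∉ s := by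
  simp [mem_maskFamily, testBit_avoidMask i (setCode_lt s), testBit_setCode]

@[simp] theorem mem_maskFamily_two_pow {b : ℕ} {s : Finset (Fin 12)} :
    s ∈ maskFamily (2 ^ b) ↔ setCode s = b := by
  simp [mem_maskFamily, Nat.testBit_two_pow, eq_comm]

-- Inserting a new point `i` adds `2 ^ i` to the code. The conjunction with `avoidMask i` discards
-- the positions where the addition would carry.
@[simp] theorem mem_maskFamily_down {i : Fin 12} {C : ℕ} {s : Finset (Fin 12)} :
    s ∈ maskFamily (downMask i C) ↔ i ∉ s ∧ insert i s ∈ maskFamily C := by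
  rw [downMask, mem_maskFamily_and, mem_maskFamily_avoid, and_comm]
  refine and_congr_right fun h => ?_
  rw [mem_maskFamily, mem_maskFamily, Nat.testBit_shiftRight, setCode_insert h, add_comm]

@[simp] theorem mem_maskFamily_up {i : Fin 12} {C : ℕ} {s : Finset (Fin 12)} :
    s ∈ maskFamily (upMask i C) ↔ i ∈ s ∧ s.erase i ∈ maskFamily C := by
  rw [upMask, mem_maskFamily_and, mem_maskFamily_compl, mem_maskFamily_avoid, not_not, and_comm]
  refine and_congr_right fun h => ?_
  rw [mem_maskFamily, mem_maskFamily, Nat.testBit_shiftLeft, ← setCode_erase h]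
  simp

/-- The mask of the union of the families `f i C` for `i` in `l`. -/
def joinMask (f : Fin 12 → ℕ → ℕ) (C : ℕ) : List (Fin 12) → ℕ
  | [] => 0
  | i :: l => f i C ||| joinMask f C l

/-- The mask of the sets that occur in the families `f i C`, for `i` in `l`, more than once. -/
def repeatMask (f : Fin 12 → ℕ → ℕ) (C : ℕ) : List (Fin 12) → ℕ
  | [] => 0
  | i :: l => (f i C &&& joinMask f C l) ||| repeatMask f C l

theorem mem_maskFamily_join_list {f : Fin 12 → ℕ → ℕ} {C : ℕ} {s : Finset (Fin 12)}
    {l : List (Fin 12)} :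
    s ∈ maskFamily (joinMask f C l) ↔ ∃ i ∈ l, s ∈ maskFamily (f i C) := by
  induction l with
  | nil => simp [joinMask]
  | cons i l ih => simp [joinMask, ih]

@[simp] theorem mem_maskFamily_join {f : Fin 12 → ℕ → ℕ} {C : ℕ} {s : Finset (Fin 12)} :
    s ∈ maskFamily (joinMask f C wittPoints) ↔ ∃ i, s ∈ maskFamily (f i C) := by
  simp [mem_maskFamily_join_list, mem_wittPoints]

theorem mem_maskFamily_repeat_list {f : Fin 12 → ℕ → ℕ} {C : ℕ} {s : Finset (Fin 12)}
    {l : List (Fin 12)} {i j : Fin 12} (hij : i ≠ j) (hi : i ∈ l) (hj : j ∈ l)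
    (hsi : s ∈ maskFamily (f i C)) (hsj : s ∈ maskFamily (f j C)) :
    s ∈ maskFamily (repeatMask f C l) := by
  induction l with
  | nil => simp at hi
  | cons a l ih =>
    simp only [repeatMask, mem_maskFamily_or, mem_maskFamily_and, mem_maskFamily_join_list]
    rcases List.mem_cons.1 hi with rfl | hi' <;> rcases List.mem_cons.1 hj with rfl | hj'
    · exact absurd rfl hij
    · exact Or.inl ⟨hsi, j, hj', hsj⟩
    · exact Or.inl ⟨hsj, i, hi', hsi⟩
    · exact Or.inr (ih hi' hj')

theorem eq_of_notMem_repeat {f : Fin 12 → ℕ → ℕ} {C : ℕ} {s : Finset (Fin 12)}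
    (h : s ∉ maskFamily (repeatMask f C wittPoints)) {i j : Fin 12}
    (hi : s ∈ maskFamily (f i C)) (hj : s ∈ maskFamily (f j C)) : i = j := by
  by_contra hij
  exact h (mem_maskFamily_repeat_list hij (mem_wittPoints i) (mem_wittPoints j) hi hj)

/-- The mask of the family of the sets of size `k`. -/
def layerMask : ℕ → ℕ
  | 0 => 1
  | k + 1 => joinMask upMask (layerMask k) wittPoints

@[simp] theorem mem_maskFamily_layer {k : ℕ} {s : Finset (Fin 12)} :
    s ∈ maskFamily (layerMask k) ↔ s.card = k := by
  induction k generalizing s with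
  | zero =>
    have h : setCode ∅ = 0 := by simp [setCode]
    rw [layerMask, ← pow_zero 2, mem_maskFamily_two_pow, Finset.card_eq_zero, ← h]
    exact setCode_injective.eq_iff
  | succ k ih =>
    simp only [layerMask, mem_maskFamily_join, mem_maskFamily_up, ih]
    constructor
    · rintro ⟨i, hi, h⟩
      rw [← h, Finset.card_erase_add_one hi]
    · intro h
      obtain ⟨i, hi⟩ := Finset.card_pos.1 (by omega : 0 < s.card)
      exact ⟨i, hi, by rw [Finset.card_erase_of_mem hi, h, Nat.add_sub_cancel]⟩

theorem maskFamily_subset_of_and_eq {C D : ℕ} (h : C &&& D = C) : maskFamily C ⊆ maskFamily D := by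
  intro s hs
  rw [← h, mem_maskFamily_and] at hs
  exact hs.2

/-! ### The action of permutations on masks -/

/-- The image of a family under the transposition of `i` and `j`. -/
def swapMask (i j : Fin 12) (C : ℕ) : ℕ :=
  (C &&& (avoidMask i &&& avoidMask j)) ||| (C &&& complMask (avoidMask i ||| avoidMask j)) |||
    (upMask j (downMask i (C &&& avoidMask j)) ||| upMask i (downMask j (C &&& avoidMask i)))

/-- The image of a family under a sequence of transpositions. -/
def permMask (t : List (Fin 12 × Fin 12)) (C : ℕ) : ℕ :=
  t.foldl (fun D p => swapMask p.1 p.2 D) C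

theorem mem_smul_swap {i j x : Fin 12} {s : Finset (Fin 12)} :
    x ∈ Equiv.swap i j • s ↔ Equiv.swap i j x ∈ s := by
  rw [← Finset.inv_smul_mem_iff, Equiv.swap_inv, Equiv.Perm.smul_def]

theorem mem_maskFamily_swap {i j : Fin 12} {C : ℕ} {s : Finset (Fin 12)} :
    s ∈ maskFamily (swapMask i j C) ↔ Equiv.swap i j • s ∈ maskFamily C := by
  -- For `i = j` the two moving parts of `swapMask` are empty and the two fixed parts make up the
  -- family.
  rcases eq_or_ne i j with rfl | hij
  · rw [Equiv.swap_self, ← Equiv.Perm.one_def, one_smul]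
    by_cases h : i ∈ s <;> simp [swapMask, h]
  by_cases hi : i ∈ s <;> by_cases hj : j ∈ s
  · have : Equiv.swap i j • s = s := by
      ext x; rw [mem_smul_swap, Equiv.swap_apply_def]; split_ifs <;> simp_all
    simp [swapMask, this, hi, hj, hij, hij.symm]
  · have : Equiv.swap i j • s = insert j (s.erase i) := by
      ext x; rw [mem_smul_swap, Equiv.swap_apply_def]; split_ifs <;> simp_all
    simp [swapMask, this, hi, hj, hij, hij.symm]
  · have : Equiv.swap i j • s = insert i (s.erase j) := by
      ext x; rw [mem_smul_swap, Equiv.swap_apply_def]; split_ifs <;> simp_all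
    simp [swapMask, this, hi, hj, hij, hij.symm]
  · have : Equiv.swap i j • s = s := by
      ext x; rw [mem_smul_swap, Equiv.swap_apply_def]; split_ifs <;> simp_all
    simp [swapMask, this, hi, hj]

theorem maskFamily_swap (i j : Fin 12) (C : ℕ) :
    maskFamily (swapMask i j C) = Equiv.swap i j • maskFamily C := by
  ext s
  rw [mem_maskFamily_swap, Set.mem_smul_set_iff_inv_smul_mem, Equiv.swap_inv]

theorem exists_maskFamily_perm (t : List (Fin 12 × Fin 12)) :
    ∃ σ : Equiv.Perm (Fin 12), ∀ C, maskFamily (permMask t C) = σ • maskFamily C := by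
  induction t with
  | nil => exact ⟨1, fun C => by simp [permMask]⟩
  | cons p t ih =>
    obtain ⟨σ, hσ⟩ := ih
    refine ⟨σ * Equiv.swap p.1 p.2, fun C => ?_⟩
    rw [mul_smul, ← maskFamily_swap, ← hσ]
    rfl

/-! ### Steiner systems `S(5, 6, 12)` as families of sets -/

/-- A family of 6-subsets of the twelve points that covers each 5-subset exactly once. -/
structure IsHexadSystem (F : Set (Finset (Fin 12))) : Prop where
  card_eq : ∀ s ∈ F, s.card = 6
  existsUnique_insert : ∀ q : Finset (Fin 12), q.card = 5 → ∃! i, i ∉ q ∧ insert i q ∈ F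

namespace IsHexadSystem

variable {F G : Set (Finset (Fin 12))}

theorem smul (hF : IsHexadSystem F) (σ : Equiv.Perm (Fin 12)) : IsHexadSystem (σ • F) := by
  refine ⟨fun s hs => ?_, fun q hq => ?_⟩
  · have := hF.card_eq _ (Set.mem_smul_set_iff_inv_smul_mem.1 hs)
    rwa [Finset.card_smul_finset] at this
  · obtain ⟨i, ⟨hi, hiF⟩, huniq⟩ := hF.existsUnique_insert (σ⁻¹ • q) (by simpa using hq)
    refine ⟨σ • i, ⟨fun h => hi (Finset.mem_inv_smul_finset_iff.2 h), ?_⟩, fun j hj => ?_⟩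
    · rwa [Set.mem_smul_set_iff_inv_smul_mem, Finset.smul_finset_insert, inv_smul_smul]
    · rw [← huniq (σ⁻¹ • j) ⟨fun h => hj.1 (Finset.smul_mem_smul_finset_iff _ |>.1 h), ?_⟩, smul_inv_smul]
      · have := Set.mem_smul_set_iff_inv_smul_mem.1 hj.2
        rwa [Finset.smul_finset_insert] at this

theorem eq_of_erase_eq (hF : IsHexadSystem F) {s t : Finset (Fin 12)} (hs : s ∈ F) (ht : t ∈ F)
    {i j : Fin 12} (hi : i ∈ s) (hj : j ∈ t) (h : s.erase i = t.erase j) : s = t := by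
  have hcard : (s.erase i).card = 5 := by rw [Finset.card_erase_of_mem hi, hF.card_eq s hs]
  have hij := (hF.existsUnique_insert _ hcard).unique (y₁ := i) (y₂ := j)
    ⟨Finset.notMem_erase i s, by rwa [Finset.insert_erase hi]⟩
    ⟨by rw [h]; exact Finset.notMem_erase j t, by rwa [h, Finset.insert_erase hj]⟩
  rw [← Finset.insert_erase hi, h, hij, Finset.insert_erase hj]

/-- A member of `G` shares a 5-subset with some member of `F`; both lie in `G`, so they coincide. -/
theorem eq_of_subset (hF : IsHexadSystem F) (hG : IsHexadSystem G) (h : F ⊆ G) : F = G := by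
  refine h.antisymm fun s hs => ?_
  have hcard := hG.card_eq s hs
  obtain ⟨i, hi⟩ := Finset.card_pos.1 (by omega : 0 < s.card)
  have hq : (s.erase i).card = 5 := by rw [Finset.card_erase_of_mem hi, hcard]
  obtain ⟨j, ⟨hj, hjF⟩, -⟩ := hF.existsUnique_insert _ hq
  rwa [← hG.eq_of_erase_eq (h hjF) hs (Finset.mem_insert_self j _) hi
    (Finset.erase_insert hj)]

end IsHexadSystem

/-! ### Propagation -/

/-- The mask of the members of `C` that are the only members over some 5-set. -/
def forcedMask (C : ℕ) : ℕ :=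
  C &&& joinMask upMask
    (layerMask 5 &&& complMask (repeatMask downMask C wittPoints)) wittPoints

/-- The mask of the sets that are in `K` or at distance different from two to all sets in `K`. -/
def compatMask (K : ℕ) : ℕ :=
  complMask (joinMask upMask (joinMask downMask K wittPoints) wittPoints) ||| K

/-- The family without the sets that are in conflict with a forced member. -/
def stepMask (C : ℕ) : ℕ := C &&& compatMask (forcedMask C)

/-- Evaluates the argument of a function to a numeral before the function is applied. -/
def strictApply {α : Type*} (n : ℕ) (f : ℕ → α) : α := Nat.rec (f 0) (fun m _ => f (m + 1)) n

@[simp] theorem strictApply_eq {α : Type*} (n : ℕ) (f : ℕ → α) : strictApply n f = f n := by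
  cases n <;> rfl

/-- Iterates `stepMask` until it changes nothing, at most `n` times. -/
def settleMask : ℕ → ℕ → ℕ
  | 0, C => C
  | n + 1, C => strictApply (stepMask C) fun D => if D = C then C else settleMask n D

/-- `F` must cover the 5-set in question, and `C` leaves only one candidate. -/
theorem IsHexadSystem.maskFamily_forced_subset {F : Set (Finset (Fin 12))} (hF : IsHexadSystem F)
    {C : ℕ} (h : F ⊆ maskFamily C) : maskFamily (forcedMask C) ⊆ F := by
  intro s hs
  simp only [forcedMask, mem_maskFamily_and, mem_maskFamily_join, mem_maskFamily_up,
    mem_maskFamily_layer, mem_maskFamily_compl] at hs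
  obtain ⟨hsC, i, hi, hcard, hrep⟩ := hs
  obtain ⟨j, ⟨hj, hjF⟩, -⟩ := hF.existsUnique_insert _ hcard
  have hij := eq_of_notMem_repeat hrep (i := i) (j := j)
    (mem_maskFamily_down.2 ⟨Finset.notMem_erase i s, by rwa [Finset.insert_erase hi]⟩)
    (mem_maskFamily_down.2 ⟨hj, h hjF⟩)
  rwa [← hij, Finset.insert_erase hi] at hjF

theorem IsHexadSystem.subset_compat {F : Set (Finset (Fin 12))} (hF : IsHexadSystem F)
    {K : ℕ} (h : maskFamily K ⊆ F) : F ⊆ maskFamily (compatMask K) := by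
  intro s hs
  simp only [compatMask, mem_maskFamily_or, mem_maskFamily_compl, mem_maskFamily_join,
    mem_maskFamily_up, mem_maskFamily_down]
  refine or_iff_not_imp_left.2 fun hn => ?_
  obtain ⟨i, hi, j, hj, hK⟩ := not_not.1 hn
  rwa [hF.eq_of_erase_eq hs (h hK) hi (Finset.mem_insert_self j _) (Finset.erase_insert hj).symm]

theorem IsHexadSystem.subset_settle {F : Set (Finset (Fin 12))} (hF : IsHexadSystem F)
    {n C : ℕ} (h : F ⊆ maskFamily C) : F ⊆ maskFamily (settleMask n C) := by
  induction n generalizing C with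
  | zero => exact h
  | succ n ih =>
    rw [settleMask, strictApply_eq]
    split_ifs with hD
    · exact h
    · exact ih fun s hs => mem_maskFamily_and.2
        ⟨h hs, hF.subset_compat (hF.maskFamily_forced_subset h) hs⟩

/-- Tests whether some 5-set is in no member of the family. -/
def hasUncovered (C : ℕ) : Bool :=
  fullMask &&& (layerMask 5 &&& complMask (joinMask downMask C wittPoints)) != 0

theorem IsHexadSystem.not_subset_of_hasUncovered {F : Set (Finset (Fin 12))}
    (hF : IsHexadSystem F) {C : ℕ} (hC : hasUncovered C = true) : ¬ F ⊆ maskFamily C := by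
  intro h
  obtain ⟨m, hm⟩ := Nat.exists_testBit_of_ne_zero (bne_iff_ne.1 hC)
  -- The factor `fullMask` in `hasUncovered` bounds the position, which is therefore the code of a
  -- set.
  rw [Nat.testBit_and, Bool.and_eq_true, testBit_fullMask_iff] at hm
  obtain ⟨q, rfl⟩ := exists_setCode hm.1
  have hq := mem_maskFamily.2 hm.2
  simp only [mem_maskFamily_and, mem_maskFamily_layer, mem_maskFamily_compl, mem_maskFamily_join,
    mem_maskFamily_down] at hq
  obtain ⟨i, ⟨hi, hiF⟩, -⟩ := hF.existsUnique_insert _ hq.1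
  exact hq.2 ⟨i, hi, h hiF⟩

/-! ### The search -/

/-- A certificate of a search for all Steiner systems within a family. At a leaf the family is
seen to contain none, or is mapped into a family that has been dealt with. At a node the search
splits according to the membership of the set with a given code. -/
inductive SearchTree
  | dead
  | sym (t : List (Fin 12 × Fin 12))
  | split (b : ℕ) (l r : SearchTree)

/-- Checks a certificate for the family `C`, given the masks of the families that have been dealt
with. All permutations used have to preserve the family `Z`. -/
def SearchTree.check (Z : ℕ) : SearchTree → List ℕ → ℕ → Bool
  | dead, _, C => strictApply (settleMask 12 C) hasUncovered
  | sym t, E, C => permMask t Z == Z &&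
      strictApply (settleMask 12 C) fun D => strictApply (permMask t D) fun D' =>
        E.any fun A => (D' &&& A) == D'
  | split b l r, E, C => strictApply (settleMask 12 C) fun D =>
      strictApply (D &&& compatMask (2 ^ b)) fun D₁ => l.check Z E D₁ &&
        strictApply (D &&& complMask (2 ^ b)) fun D₂ => r.check Z (D₁ :: E) D₂

/-- Every Steiner system within `C` is mapped to `T` by a permutation that preserves `Z`. -/
def IsSolvedMask (Z T C : ℕ) : Prop :=
  ∀ F, IsHexadSystem F → F ⊆ maskFamily C →
    ∃ σ : Equiv.Perm (Fin 12), σ • maskFamily Z = maskFamily Z ∧ σ • F = maskFamily T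

/-- Once the left branch of a split is solved, its family joins `E`, and leaves of the right branch
may be mapped into it. Permutations compose along such references, and all of them fix `Z`. -/
theorem SearchTree.isSolvedMask_of_check {Z T : ℕ} (c : SearchTree) {E : List ℕ} {C : ℕ}
    (h : c.check Z E C = true) (hE : ∀ A ∈ E, IsSolvedMask Z T A) : IsSolvedMask Z T C := by
  induction c generalizing E C with
  | dead =>
    intro F hF hC
    rw [check, strictApply_eq] at h
    exact absurd (hF.subset_settle hC) (hF.not_subset_of_hasUncovered h)
  | sym t =>
    intro F hF hC
    simp only [check, strictApply_eq, Bool.and_eq_true, beq_iff_eq, List.any_eq_true] at h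
    obtain ⟨hZ, A, hA, hsub⟩ := h
    obtain ⟨σ, hσ⟩ := exists_maskFamily_perm t
    have hFA : σ • F ⊆ maskFamily A := by
      refine (Set.smul_set_mono (hF.subset_settle (n := 12) hC)).trans ?_
      rw [← hσ]
      exact maskFamily_subset_of_and_eq hsub
    obtain ⟨τ, hτZ, hτ⟩ := hE A hA _ (hF.smul σ) hFA
    exact ⟨τ * σ, by rw [mul_smul, ← hσ, hZ, hτZ], by rw [mul_smul, hτ]⟩
  | split b l r ihl ihr =>
    simp only [check, strictApply_eq, Bool.and_eq_true] at h
    have hl := ihl h.1 hE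
    have hr := ihr h.2 (List.forall_mem_cons.2 ⟨hl, hE⟩)
    intro F hF hC
    have hD := hF.subset_settle (n := 12) hC
    by_cases hb : ∃ s ∈ F, setCode s = b
    · obtain ⟨s, hs, rfl⟩ := hb
      refine hl F hF fun t ht => mem_maskFamily_and.2 ⟨hD ht, hF.subset_compat ?_ ht⟩
      intro t ht
      rwa [setCode_injective (mem_maskFamily_two_pow.1 ht)]
    · refine hr F hF fun t ht => mem_maskFamily_and.2 ⟨hD ht, ?_⟩
      rw [mem_maskFamily_compl, mem_maskFamily_two_pow]
      exact fun h => hb ⟨t, ht, h⟩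

/-! ### Maximum cliques and automorphisms of Johnson graphs -/

section Johnson

variable {n k : ℕ}

theorem johnsonGraph_adj_iff {s t : JohnsonVertex n k} :
    (johnsonGraph n k).Adj s t ↔ (s.1 ∩ t.1).card + 1 = k := by
  have h1 := Finset.card_inter_add_card_sdiff s.1 t.1
  have h2 := Finset.card_inter_add_card_sdiff t.1 s.1
  have h3 : (symmDiff s.1 t.1).card = (s.1 \ t.1).card + (t.1 \ s.1).card := by
    rw [Finset.symmDiff_def, Finset.card_union_of_disjoint disjoint_sdiff_sdiff]
  rw [Finset.inter_comm] at h2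
  rw [s.2] at h1
  rw [t.2] at h2
  change (symmDiff s.1 t.1).card = 2 ↔ _
  omega

/-- The vertices that contain `q`. -/
def upperClique (q : Finset (Fin n)) : Finset (JohnsonVertex n k) := {s | q ⊆ s.1}

/-- The vertices that are contained in `u`. -/
def lowerClique (u : Finset (Fin n)) : Finset (JohnsonVertex n k) := {s | s.1 ⊆ u}

theorem mem_upperClique {q : Finset (Fin n)} {s : JohnsonVertex n k} :
    s ∈ upperClique q ↔ q ⊆ s.1 := by simp [upperClique]

theorem mem_lowerClique {u : Finset (Fin n)} {s : JohnsonVertex n k} :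
    s ∈ lowerClique u ↔ s.1 ⊆ u := by simp [lowerClique]

theorem isClique_upperClique {q : Finset (Fin n)} (hq : q.card + 1 = k) :
    (johnsonGraph n k).IsClique (upperClique q : Finset (JohnsonVertex n k)) := by
  intro s hs t ht hst
  rw [Finset.mem_coe, mem_upperClique] at hs ht
  rw [johnsonGraph_adj_iff]
  have h1 : q.card ≤ (s.1 ∩ t.1).card := Finset.card_le_card (Finset.subset_inter hs ht)
  have h2 : (s.1 ∩ t.1).card < k := by
    refine lt_of_lt_of_eq ?_ s.2
    refine Finset.card_lt_card (Finset.inter_subset_left.ssubset_of_ne fun h => hst ?_)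
    exact Subtype.ext (Finset.eq_of_subset_of_card_le (Finset.inter_eq_left.1 h)
      (by rw [s.2, t.2]))
  omega

theorem isClique_lowerClique {u : Finset (Fin n)} (hu : u.card = k + 1) :
    (johnsonGraph n k).IsClique (lowerClique u : Finset (JohnsonVertex n k)) := by
  intro s hs t ht hst
  rw [Finset.mem_coe, mem_lowerClique] at hs ht
  rw [johnsonGraph_adj_iff]
  have h1 := Finset.card_union_add_card_inter s.1 t.1
  have h2 : (s.1 ∪ t.1).card ≤ u.card := Finset.card_le_card (Finset.union_subset hs ht)
  have h3 : k < (s.1 ∪ t.1).card := by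
    refine s.2.symm.trans_lt ?_
    refine Finset.card_lt_card (Finset.subset_union_left.ssubset_of_ne fun h => hst ?_)
    exact (Subtype.ext (Finset.eq_of_subset_of_card_le (Finset.union_eq_left.1 h.symm)
      (by rw [s.2, t.2]))).symm
  rw [s.2, t.2] at h1
  omega

theorem card_upperClique {q : Finset (Fin n)} (hq : q.card + 1 = k) :
    (upperClique q : Finset (JohnsonVertex n k)).card = n - q.card := by
  have : qᶜ.card = n - q.card := by rw [Finset.card_compl, Fintype.card_fin]
  rw [← this]
  symm
  refine Finset.card_bij (fun i hi => ⟨insert i q, ?_⟩) ?_ ?_ ?_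
  · rw [Finset.card_insert_of_notMem (Finset.mem_compl.1 hi), hq]
  · intro i hi
    rw [mem_upperClique]
    exact Finset.subset_insert i q
  · intro i hi j hj h
    have h' : insert i q = insert j q := congrArg Subtype.val h
    have := h' ▸ Finset.mem_insert_self i q
    exact (Finset.mem_insert.1 this).resolve_right (Finset.mem_compl.1 hi)
  · intro s hs
    rw [mem_upperClique] at hs
    obtain ⟨i, hi, h⟩ := (Finset.covBy_iff_exists_insert).1
      (Finset.covBy_iff_card_sdiff_eq_one.2 ⟨hs, by
        rw [Finset.card_sdiff_of_subset hs, s.2]; omega⟩)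
    exact ⟨i, Finset.mem_compl.2 hi, Subtype.ext h⟩

theorem card_lowerClique {u : Finset (Fin n)} (hu : u.card = k + 1) :
    (lowerClique u : Finset (JohnsonVertex n k)).card = k + 1 := by
  rw [← hu]
  symm
  refine Finset.card_bij (fun i hi => ⟨u.erase i, ?_⟩) ?_ ?_ ?_
  · rw [Finset.card_erase_of_mem hi, hu, Nat.add_sub_cancel]
  · intro i hi
    rw [mem_lowerClique]
    exact Finset.erase_subset i u
  · intro i hi j hj h
    exact Finset.erase_injOn u hi hj (congrArg Subtype.val h)
  · intro s hs
    rw [mem_lowerClique] at hs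
    obtain ⟨i, hi, h⟩ := (Finset.covBy_iff_exists_insert).1
      (Finset.covBy_iff_card_sdiff_eq_one.2 ⟨hs, by
        rw [Finset.card_sdiff_of_subset hs, s.2]; omega⟩)
    refine ⟨i, h ▸ Finset.mem_insert_self i _, Subtype.ext ?_⟩
    change u.erase i = s.1
    rw [← h, Finset.erase_insert hi]

/-- A clique with two vertices lies in an upper or in a lower clique. -/
theorem subset_upperClique_or_lowerClique {B : Finset (JohnsonVertex n k)}
    (hB : (johnsonGraph n k).IsClique B) {s t : JohnsonVertex n k} (hs : s ∈ B) (ht : t ∈ B)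
    (hst : s ≠ t) :
    ∃ q u : Finset (Fin n), q.card + 1 = k ∧ u.card = k + 1 ∧
      (B ⊆ upperClique q ∨ B ⊆ lowerClique u) := by
  have hinter := johnsonGraph_adj_iff.1 (hB hs ht hst)
  have hunion := Finset.card_union_add_card_inter s.1 t.1
  rw [s.2, t.2] at hunion
  have hpair : ∀ r ∈ B, ∀ r' ∈ B, k ≤ (r.1 ∩ r'.1).card + 1 := by
    intro r hr r' hr'
    rcases eq_or_ne r r' with rfl | hne
    · rw [Finset.inter_self, r.2]
      exact k.le_succ
    · exact (johnsonGraph_adj_iff.1 (hB hr hr' hne)).ge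
  -- Both `r ∩ s` and `r ∩ t` have at least `k - 1` points, and their union has at most `k - 1`.
  -- Hence their intersection has at least `k - 1` points and is all of `s ∩ t`.
  have hout : ∀ r ∈ B, ¬ r.1 ⊆ s.1 ∪ t.1 →
      (r.1 ∩ (s.1 ∪ t.1)).card + 1 ≤ k ∧ s.1 ∩ t.1 ⊆ r.1 := by
    intro r hr hru
    have h1 : (r.1 ∩ (s.1 ∪ t.1)).card < k := lt_of_lt_of_eq
      (Finset.card_lt_card (Finset.inter_subset_left.ssubset_of_ne
        fun h => hru (Finset.inter_eq_left.1 h))) r.2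
    have h2 := Finset.card_union_add_card_inter (r.1 ∩ s.1) (r.1 ∩ t.1)
    rw [← Finset.inter_union_distrib_left, ← Finset.inter_inter_distrib_left] at h2
    have h3 := hpair r hr s hs
    have h4 := hpair r hr t ht
    refine ⟨h1, Finset.inter_eq_right.1 (Finset.eq_of_subset_of_card_le
      Finset.inter_subset_right (by omega))⟩
  refine ⟨s.1 ∩ t.1, s.1 ∪ t.1, hinter, by omega, ?_⟩
  by_contra! hcon
  obtain ⟨r, hr, hrq⟩ := Finset.not_subset.1 hcon.1
  obtain ⟨r', hr', hru⟩ := Finset.not_subset.1 hcon.2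
  rw [mem_upperClique] at hrq
  rw [mem_lowerClique] at hru
  have hr_sub : r.1 ⊆ s.1 ∪ t.1 := by
    by_contra h
    exact hrq (hout r hr h).2
  obtain ⟨hcard, hq⟩ := hout r' hr' hru
  -- Since `r` lies inside `s ∪ t`, this forces `r ∩ r' ⊆ s ∩ t`. By size the two are equal, so `r`
  -- contains `s ∩ t` after all.
  have heq : s.1 ∩ t.1 = r'.1 ∩ (s.1 ∪ t.1) := Finset.eq_of_subset_of_card_le
    (Finset.subset_inter hq (Finset.inter_subset_left.trans Finset.subset_union_left)) (by omega)
  have hsub : r.1 ∩ r'.1 ⊆ s.1 ∩ t.1 := by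
    rw [heq]
    exact fun x hx => Finset.mem_inter.2
      ⟨(Finset.mem_inter.1 hx).2, hr_sub (Finset.mem_inter.1 hx).1⟩
  have h5 := hpair r hr r' hr'
  have h6 := Finset.eq_of_subset_of_card_le hsub (by omega)
  exact hrq (h6 ▸ Finset.inter_subset_left)

theorem isMaximumClique_johnsonGraph_iff (hk : 0 < k) (hn : n = 2 * k)
    {B : Finset (JohnsonVertex n k)} :
    (johnsonGraph n k).IsMaximumClique B ↔
      (∃ q : Finset (Fin n), q.card + 1 = k ∧ B = upperClique q) ∨
        ∃ u : Finset (Fin n), u.card = k + 1 ∧ B = lowerClique u := by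
  -- Upper cliques have `n - k + 1` vertices and lower ones `k + 1`; for `n = 2 * k` the sizes
  -- agree, so both kinds are maximum.
  have hupper : ∀ q : Finset (Fin n), q.card + 1 = k →
      (upperClique q : Finset (JohnsonVertex n k)).card = k + 1 := by
    intro q hq
    rw [card_upperClique hq]
    omega
  have hmax : ∀ B : Finset (JohnsonVertex n k), (johnsonGraph n k).IsClique B → k + 1 ≤ B.card →
      (∃ q : Finset (Fin n), q.card + 1 = k ∧ B = upperClique q) ∨
        ∃ u : Finset (Fin n), u.card = k + 1 ∧ B = lowerClique u := by
    intro B hB hcard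
    obtain ⟨s, hs, t, ht, hst⟩ := Finset.one_lt_card.1 (by omega : 1 < B.card)
    obtain ⟨q, u, hq, hu, h | h⟩ := subset_upperClique_or_lowerClique hB hs ht hst
    · exact Or.inl ⟨q, hq, Finset.eq_of_subset_of_card_le h (by rw [hupper q hq]; exact hcard)⟩
    · exact Or.inr ⟨u, hu, Finset.eq_of_subset_of_card_le h
        (by rw [card_lowerClique hu]; exact hcard)⟩
  have hle : ∀ B : Finset (JohnsonVertex n k), (johnsonGraph n k).IsClique B → B.card ≤ k + 1 := by
    intro B hB
    by_contra! hlt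
    obtain ⟨q, hq, rfl⟩ | ⟨u, hu, rfl⟩ := hmax B hB hlt.le
    · exact hlt.ne' (hupper q hq)
    · exact hlt.ne' (card_lowerClique hu)
  constructor
  · intro hB
    obtain ⟨q, -, hq⟩ := Finset.exists_subset_card_eq
      (s := (Finset.univ : Finset (Fin n))) (n := k - 1) (by simp; omega)
    have hq' : q.card + 1 = k := by omega
    exact hmax B hB.isClique ((hupper q hq').ge.trans (hB.maximum _ (isClique_upperClique hq')))
  · rintro (⟨q, hq, rfl⟩ | ⟨u, hu, rfl⟩)
    · exact ⟨isClique_upperClique hq, fun t ht => (hle t ht).trans (hupper q hq).ge⟩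
    · exact ⟨isClique_lowerClique hu, fun t ht => (hle t ht).trans (card_lowerClique hu).ge⟩

/-- The automorphism of the Johnson graph induced by a permutation of the coordinates. -/
def johnsonPerm (σ : Equiv.Perm (Fin n)) : johnsonGraph n k ≃g johnsonGraph n k where
  toFun s := ⟨σ • s.1, by rw [Finset.card_smul_finset, s.2]⟩
  invFun s := ⟨σ⁻¹ • s.1, by rw [Finset.card_smul_finset, s.2]⟩
  left_inv s := Subtype.ext (inv_smul_smul σ s.1)
  right_inv s := Subtype.ext (smul_inv_smul σ s.1)
  map_rel_iff' := by
    intro s t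
    rw [johnsonGraph_adj_iff, johnsonGraph_adj_iff]
    change (σ • s.1 ∩ σ • t.1).card + 1 = k ↔ _
    rw [← Finset.smul_finset_inter, Finset.card_smul_finset]

theorem image_val_johnsonPerm (σ : Equiv.Perm (Fin n)) (W : Set (JohnsonVertex n k)) :
    Subtype.val '' (johnsonPerm σ '' W) = σ • (Subtype.val '' W) := by
  rw [← Set.image_smul, Set.image_image, Set.image_image]
  rfl

end Johnson

/-! ### A Steiner system and a disjoint image of it -/

/-- The mask of the Steiner system `S(5, 6, 12)` that is determined by five of its members. -/
def wittMask : ℕ :=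
  settleMask 12 ([63, 783, 1175, 603, 1117].foldl (fun C b => C &&& compatMask (2 ^ b))
    (layerMask 6))

/-- A sequence of transpositions that moves the family of `wittMask` to a disjoint one. -/
def wittShift : List (Fin 12 × Fin 12) := [(0, 1), (4, 11), (0, 8), (5, 6), (0, 11)]

theorem wittMask_and_layer : wittMask &&& layerMask 6 = wittMask := by decide +kernel

theorem wittMask_and_shift : wittMask &&& permMask wittShift wittMask = 0 := by decide +kernel

/-- The 5-sets account for the upper cliques and the 7-sets for the lower ones; `wittMask_repeat`
supplies the uniqueness. -/
theorem wittMask_cover :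
    layerMask 5 &&& joinMask downMask wittMask wittPoints = layerMask 5 ∧
      layerMask 7 &&& joinMask upMask wittMask wittPoints = layerMask 7 := by decide +kernel

theorem wittMask_repeat :
    layerMask 5 &&& repeatMask downMask wittMask wittPoints = 0 ∧
      layerMask 7 &&& repeatMask upMask wittMask wittPoints = 0 := by decide +kernel

/-- A certificate that every Steiner system is an image of `wittMask`. -/
def wittTree : SearchTree :=
  .split 63 (.split 207 (.split 783 (.split 343 (.split 1175 (.split 603 (.split 1117 (.sym [])
    (.sym [(6, 7), (8, 10), (9, 11)])) (.split 1115 (.split 605 (.sym [(6, 11), (7, 10),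
    (8, 9)]) (.sym [(6, 9), (7, 8), (7, 11), (6, 10)])) (.split 605 (.sym [(6, 10), (7, 11),
    (7, 8), (6, 9)]) (.sym [(6, 8), (7, 9), (10, 11)])))) (.sym [(10, 11)])) (.split 599 (.sym
    [(8, 9)]) (.split 1111 (.split 407 (.sym [(4, 5)]) (.sym [(4, 5)])) (.sym [(10, 11)]))))
    (.split 1295 (.sym [(9, 10)]) (.sym [(8, 9)]))) (.split 335 (.sym [(7, 8)]) (.split 591
    (.sym [(7, 9)]) (.split 1103 (.sym [(7, 10)]) (.sym [(7, 11)]))))) (.split 95 (.sym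
    [(5, 6)]) (.split 159 (.sym [(5, 7)]) (.split 287 (.sym [(5, 8)]) (.split 543 (.sym
    [(5, 9)]) (.split 1055 (.sym [(5, 10)]) (.sym [(5, 11)]))))))

/-- A certificate that the Steiner systems disjoint from `wittMask` are equivalent. -/
def disjointTree : SearchTree :=
  .split 95 (.split 231 (.split 839 (.split 363 (.split 1134 .dead (.sym [(0, 9), (1, 8),
    (2, 11), (1, 3), (4, 7), (0, 6), (4, 10), (4, 6)])) (.split 619 (.split 1133 .dead .dead)
    (.split 621 (.sym [(1, 2), (1, 8), (3, 4), (3, 5), (3, 7), (3, 6), (6, 11), (1, 6), (1, 9),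
    (9, 10)]) .dead))) (.split 363 (.split 1134 (.sym [(0, 7), (1, 5), (2, 3), (2, 8), (1, 11),
    (0, 10)]) .dead) (.split 619 (.split 1133 .dead (.sym [(0, 6), (1, 3), (2, 9), (1, 2),
    (4, 5), (1, 4), (0, 8), (4, 7), (0, 11), (0, 7)])) .dead))) (.split 359 (.sym [(1, 2),
    (3, 4), (7, 8), (9, 10)]) (.split 615 (.split 235 (.sym [(0, 1), (2, 3), (8, 9), (10, 11)])
    (.split 363 (.split 1139 (.split 249 (.sym [(0, 4), (1, 11), (2, 9), (0, 3), (1, 3), (2, 5),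
    (5, 6), (6, 8)]) (.sym [(0, 8), (1, 9), (3, 11), (4, 6), (1, 5), (0, 4), (5, 7), (4, 7)]))
    (.sym [(0, 1), (2, 3), (8, 9), (10, 11)])) (.split 237 (.sym [(0, 1), (0, 4), (0, 3),
    (7, 8), (7, 11), (7, 10)]) (.sym [(0, 1), (0, 4), (0, 3), (7, 8), (7, 11), (7, 10)]))))
    (.sym [(1, 2), (3, 4), (7, 8), (9, 10)])))) (.split 159 (.sym [(2, 3), (6, 7), (8, 11),
    (9, 10)]) (.split 287 (.sym [(2, 4), (2, 3), (6, 9), (7, 11), (6, 8), (7, 10)]) (.split 543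
    (.sym [(3, 4), (6, 11), (7, 9), (8, 10)]) (.split 1055 (.sym [(3, 4), (6, 11), (7, 9),
    (8, 10)]) (.sym [(3, 4), (6, 11), (7, 9), (8, 10)])))))

/-- The choices on the leftmost path include the five sets that define `wittMask`, so its leaf needs
only the identity. As `Z = 0` is the empty family, every permutation is allowed. -/
theorem wittTree_check : wittTree.check 0 [wittMask] (layerMask 6) = true := by decide +kernel

/-- The code 63 of `{0, 1, 2, 3, 4, 5}` is excluded, which leaves six candidates over `{0, 1, 2, 3,
4}`. Automorphisms of `wittMask` reduce all of them to the first, 95. -/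
theorem disjointTree_check :
    disjointTree.check wittMask [permMask wittShift wittMask]
      (layerMask 6 &&& complMask wittMask) = true := by
  decide +kernel

theorem isHexadSystem_wittMask : IsHexadSystem (maskFamily wittMask) := by
  refine ⟨fun s hs => ?_, fun q hq => ?_⟩
  · exact mem_maskFamily_layer.1 (maskFamily_subset_of_and_eq wittMask_and_layer hs)
  · have hq5 := mem_maskFamily_layer.2 hq
    have hcover := maskFamily_subset_of_and_eq wittMask_cover.1 hq5
    rw [mem_maskFamily_join] at hcover
    obtain ⟨i, hi⟩ := hcover
    have hrep : q ∉ maskFamily (repeatMask downMask wittMask wittPoints) := fun h => by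
      have := mem_maskFamily_and.2 ⟨hq5, h⟩
      rw [wittMask_repeat.1, maskFamily_zero] at this
      exact this
    exact ⟨i, mem_maskFamily_down.1 hi, fun j hj =>
      eq_of_notMem_repeat hrep (mem_maskFamily_down.2 hj) hi⟩

theorem existsUnique_erase_mem_wittMask {u : Finset (Fin 12)} (hu : u.card = 7) :
    ∃! i, i ∈ u ∧ u.erase i ∈ maskFamily wittMask := by
  have hu7 := mem_maskFamily_layer.2 hu
  have hcover := maskFamily_subset_of_and_eq wittMask_cover.2 hu7
  rw [mem_maskFamily_join] at hcover
  obtain ⟨i, hi⟩ := hcover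
  have hrep : u ∉ maskFamily (repeatMask upMask wittMask wittPoints) := fun h => by
    have := mem_maskFamily_and.2 ⟨hu7, h⟩
    rw [wittMask_repeat.2, maskFamily_zero] at this
    exact this
  exact ⟨i, mem_maskFamily_up.1 hi, fun j hj =>
    eq_of_notMem_repeat hrep (mem_maskFamily_up.2 hj) hi⟩

theorem IsHexadSystem.exists_smul_eq {F : Set (Finset (Fin 12))} (hF : IsHexadSystem F) :
    ∃ σ : Equiv.Perm (Fin 12), σ • F = maskFamily wittMask := by
  -- The list of solved families starts with the target itself: a system inside `wittMask` equals
  -- it.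
  have hsolved : IsSolvedMask 0 wittMask wittMask := fun G hG h =>
    ⟨1, one_smul _ _, by rw [one_smul, hG.eq_of_subset isHexadSystem_wittMask h]⟩
  obtain ⟨σ, -, hσ⟩ := wittTree.isSolvedMask_of_check wittTree_check
    (List.forall_mem_singleton.2 hsolved) F hF
    fun s hs => mem_maskFamily_layer.2 (hF.card_eq s hs)
  exact ⟨σ, hσ⟩

theorem isHexadSystem_wittShift : IsHexadSystem (maskFamily (permMask wittShift wittMask)) := by
  obtain ⟨σ, hσ⟩ := exists_maskFamily_perm wittShift
  rw [hσ]
  exact isHexadSystem_wittMask.smul σ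

theorem IsHexadSystem.exists_smul_eq_of_disjoint {F : Set (Finset (Fin 12))}
    (hF : IsHexadSystem F) (hdisj : Disjoint (maskFamily wittMask) F) :
    ∃ σ : Equiv.Perm (Fin 12), σ • maskFamily wittMask = maskFamily wittMask ∧
      σ • F = maskFamily (permMask wittShift wittMask) := by
  have hsolved : IsSolvedMask wittMask (permMask wittShift wittMask)
      (permMask wittShift wittMask) := fun G hG h =>
    ⟨1, one_smul _ _, by rw [one_smul, hG.eq_of_subset isHexadSystem_wittShift h]⟩
  refine disjointTree.isSolvedMask_of_check disjointTree_check
    (List.forall_mem_singleton.2 hsolved) F hF fun s hs => mem_maskFamily_and.2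
      ⟨mem_maskFamily_layer.2 (hF.card_eq s hs), mem_maskFamily_compl.2 fun h => ?_⟩
  exact Set.disjoint_left.1 hdisj h hs

/-! ### Steiner systems in the Johnson graph -/

theorem IsSteinerSystem.isHexadSystem {W : Set (JohnsonVertex 12 6)} (hW : IsSteinerSystem W) :
    IsHexadSystem (Subtype.val '' W) := by
  refine ⟨?_, fun q hq => ?_⟩
  · rintro _ ⟨s, -, rfl⟩
    exact s.2
  · obtain ⟨s, ⟨hsB, hsW⟩, huniq⟩ := hW.2 (upperClique q)
      ((isMaximumClique_johnsonGraph_iff (k := 6) (by norm_num) rfl).2 (Or.inl ⟨q, by rw [hq], rfl⟩))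
    rw [mem_upperClique] at hsB
    obtain ⟨i, hi, his⟩ := Finset.covBy_iff_exists_insert.1
      (Finset.covBy_iff_card_sdiff_eq_one.2 ⟨hsB, by
        rw [Finset.card_sdiff_of_subset hsB, s.2, hq]⟩)
    refine ⟨i, ⟨hi, s, hsW, his.symm⟩, ?_⟩
    rintro j ⟨hj, t, ht, hjt⟩
    have hts : t = s := huniq t ⟨mem_upperClique.2 (hjt ▸ Finset.subset_insert j q), ht⟩
    have hjs : j ∈ insert i q := by
      rw [his, ← hts, hjt]
      exact Finset.mem_insert_self j q
    exact (Finset.mem_insert.1 hjs).resolve_right hj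

/-- The vertices of `J(12, 6)` in the family of `wittMask`. -/
def wittSystem : Set (JohnsonVertex 12 6) := {s | s.1 ∈ maskFamily wittMask}

theorem image_val_wittSystem : Subtype.val '' wittSystem = maskFamily wittMask := by
  ext s
  constructor
  · rintro ⟨t, ht, rfl⟩
    exact ht
  · intro hs
    exact ⟨⟨s, isHexadSystem_wittMask.card_eq s hs⟩, hs, rfl⟩

theorem isSteinerSystem_wittSystem : IsSteinerSystem wittSystem := by
  refine ⟨le_rfl, fun B hB => ?_⟩
  obtain ⟨q, hq, rfl⟩ | ⟨u, hu, rfl⟩ :=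
    (isMaximumClique_johnsonGraph_iff (k := 6) (by norm_num) rfl).1 hB
  · obtain ⟨i, ⟨hi, hiW⟩, -⟩ := isHexadSystem_wittMask.existsUnique_insert q (by omega)
    refine ⟨⟨_, isHexadSystem_wittMask.card_eq _ hiW⟩,
      ⟨mem_upperClique.2 (Finset.subset_insert i q), hiW⟩, ?_⟩
    rintro t ⟨htB, htW⟩
    rw [mem_upperClique] at htB
    obtain ⟨j, hj, hjt⟩ := Finset.covBy_iff_exists_insert.1
      (Finset.covBy_iff_card_sdiff_eq_one.2 ⟨htB, by
        rw [Finset.card_sdiff_of_subset htB, t.2]; omega⟩)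
    refine Subtype.ext (isHexadSystem_wittMask.eq_of_erase_eq htW hiW (i := j) (j := i)
      (hjt ▸ Finset.mem_insert_self j q) (Finset.mem_insert_self i q) ?_)
    rw [← hjt, Finset.erase_insert hj, Finset.erase_insert hi]
  · obtain ⟨i, ⟨hi, hiW⟩, huniq⟩ := existsUnique_erase_mem_wittMask hu
    refine ⟨⟨_, isHexadSystem_wittMask.card_eq _ hiW⟩,
      ⟨mem_lowerClique.2 (Finset.erase_subset i u), hiW⟩, ?_⟩
    rintro t ⟨htB, htW⟩
    rw [mem_lowerClique] at htB
    obtain ⟨j, hj, hjt⟩ := Finset.covBy_iff_exists_erase.1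
      (Finset.covBy_iff_card_sdiff_eq_one.2 ⟨htB, by
        rw [Finset.card_sdiff_of_subset htB, t.2, hu]⟩)
    refine Subtype.ext ?_
    change t.1 = u.erase i
    rw [← hjt, huniq j ⟨hj, hjt ▸ htW⟩]

theorem IsSteinerSystem.image {n k : ℕ} {W : Set (JohnsonVertex n k)} (hW : IsSteinerSystem W)
    (π : johnsonGraph n k ≃g johnsonGraph n k) : IsSteinerSystem (π '' W) := by
  classical
  refine ⟨hW.1, fun B hB => ?_⟩
  have hclique : ∀ (ρ : johnsonGraph n k ≃g johnsonGraph n k) (A : Finset (JohnsonVertex n k)),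
      (johnsonGraph n k).IsClique A →
        (johnsonGraph n k).IsClique (A.map ρ.toEquiv.toEmbedding : Finset _) := by
    intro ρ A hA
    rw [Finset.coe_map]
    rintro _ ⟨s, hs, rfl⟩ _ ⟨t, ht, rfl⟩ hst
    exact ρ.map_rel_iff.2 (hA hs ht fun h => hst (h ▸ rfl))
  obtain ⟨s, ⟨hsB, hsW⟩, huniq⟩ := hW.2 (B.map π.symm.toEquiv.toEmbedding)
    ⟨hclique _ _ hB.isClique, fun t ht => by
      have := hB.maximum _ (hclique π t ht)
      simpa using this⟩
  refine ⟨π s, ⟨?_, s, hsW, rfl⟩, ?_⟩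
  · obtain ⟨t, ht, rfl⟩ := Finset.mem_map.1 hsB
    simpa using ht
  · rintro _ ⟨hB', t, ht, rfl⟩
    rw [huniq t ⟨Finset.mem_map.2 ⟨π t, hB', π.symm_apply_apply t⟩, ht⟩]

theorem exists_isDisjointWittPair :
    ∃ W : Set (JohnsonVertex 12 6) × Set (JohnsonVertex 12 6), IsDisjointWittPair W := by
  obtain ⟨σ, hσ⟩ := exists_maskFamily_perm wittShift
  refine ⟨(wittSystem, johnsonPerm σ '' wittSystem), isSteinerSystem_wittSystem,
    isSteinerSystem_wittSystem.image _, Set.disjoint_left.2 fun s hs hs' => ?_⟩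
  have h : s.1 ∈ maskFamily (permMask wittShift wittMask) := by
    rw [hσ, ← image_val_wittSystem, ← image_val_johnsonPerm]
    exact Set.mem_image_of_mem _ hs'
  have := mem_maskFamily_and.2 ⟨hs, h⟩
  rw [wittMask_and_shift, maskFamily_zero] at this
  exact this

theorem IsDisjointWittPair.exists_smul_eq
    {W : Set (JohnsonVertex 12 6) × Set (JohnsonVertex 12 6)} (hW : IsDisjointWittPair W) :
    ∃ σ : Equiv.Perm (Fin 12), σ • (Subtype.val '' W.1) = maskFamily wittMask ∧
      σ • (Subtype.val '' W.2) = maskFamily (permMask wittShift wittMask) := by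
  obtain ⟨h₁, h₂, hdisj⟩ := hW
  obtain ⟨σ, hσ⟩ := h₁.isHexadSystem.exists_smul_eq
  -- `τ` fixes `wittMask`, so normalising the second system leaves the first in place.
  obtain ⟨τ, hτ₁, hτ₂⟩ := (h₂.isHexadSystem.smul σ).exists_smul_eq_of_disjoint (by
    rw [← hσ, Set.disjoint_smul_set]
    exact (Set.disjoint_image_iff Subtype.val_injective).2 hdisj)
  exact ⟨τ * σ, by rw [mul_smul, hσ, hτ₁], by rw [mul_smul, hτ₂]⟩

theorem corollaryc :
    (∃ W : Set (JohnsonVertex 12 6) × Set (JohnsonVertex 12 6), IsDisjointWittPair W) ∧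
    (∀ W W' : Set (JohnsonVertex 12 6) × Set (JohnsonVertex 12 6),
      IsDisjointWittPair W → IsDisjointWittPair W' →
        PairEquivalent (johnsonGraph 12 6) W W') := by
  refine ⟨exists_isDisjointWittPair, fun W W' hW hW' => ?_⟩
  obtain ⟨σ, hσ₁, hσ₂⟩ := hW.exists_smul_eq
  obtain ⟨τ, hτ₁, hτ₂⟩ := hW'.exists_smul_eq
  -- The normal form respects the order of the pair, so no exchange of the two systems is needed.
  refine ⟨johnsonPerm (σ⁻¹ * τ), Or.inl ⟨?_, ?_⟩⟩ <;>
    apply Set.image_injective.2 Subtype.val_injective <;>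
    rw [image_val_johnsonPerm, mul_smul]
  · rw [hτ₁, ← hσ₁, inv_smul_smul]
  · rw [hτ₂, ← hσ₂, inv_smul_smul]
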